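/- Let $G$ be a finite, simple, undirected graph of order $n$ (that is, with $n$ vertices) that has fewer than $\frac{11}{5}n-\frac{18}{5}$ edges. Then $G$ has a forest cut, that is, there is a set $S$ of vertices of $G$ such that the graph $G-S$ is disconnected and the subgraph $G[S]$ of $G$ induced by $S$ is a forest (a graph without cycles). Here, the empty graph is not considered to be disconnected, and the empty graph is a forest. -/

import Mathlib

namespace SimpleGraph

/-- A set `S` of vertices is a vertex cut of `G` if `G - S` is disconnected, that is, two vertices
outside of `S` are not joined by a path of `G - S`. (`Preconnected` rather than `Connected`, so that
the graph without vertices does not count as disconnected.) -/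
def IsVertexCut {V : Type*} (G : SimpleGraph V) (S : Set V) : Prop :=
  ¬ (G.induce Sᶜ).Preconnected

/-- A forest cut of `G` is a vertex cut `S` of `G` such that `G[S]` is a forest. -/
def IsForestCut {V : Type*} (G : SimpleGraph V) (S : Set V) : Prop :=
  G.IsVertexCut S ∧ (G.induce S).IsAcyclic

end SimpleGraph

/-! Take a sparse graph without forest cut on a smallest possible vertex set. A forest cut is a
colouring in which `none` marks the forest and the other two colours are never adjacent. Delete some
vertices, possibly add edges among the rest, colour the smaller graph by minimality and extend the
colouring back: every successful extension is a contradiction. In the bound `5 * degSum + 36 < 22 *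
card` a deleted vertex costs 22, a deleted edge gains 10 and an added edge costs 10. An added edge
keeps its ends from getting opposite colours, or from being connected otherwise inside the cut.

These reductions give minimum degree four (`four_le_degIn`). The neighbourhood of a vertex of degree
four contains no four-cycle (`not_square`) and hence, not being a forest, a triangle
(`exists_triangle`). At most one vertex of that triangle has degree four
(`not_three_degIn_eq_four`). Let each vertex of degree four select such a triangle; excluding one
more configuration (`not_fan`) shows that a vertex of degree five is selected at most three times
(`card_selected_le_three`). Discharging then makes the average degree at least 22/5, against
sparsity (`elim`).

Subgraphs are given by finsets of `V` and by `restrictTo`, so that deletion and reinsertion never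
change the vertex type. -/

namespace SimpleGraph

/-! ### Forests under insertion of a vertex -/

variable {V : Type*}

/-- The graph on all of `V` whose edges are the edges of `G` inside `S`. -/
def restrictTo (G : SimpleGraph V) (S : Set V) : SimpleGraph V where
  Adj x y := G.Adj x y ∧ x ∈ S ∧ y ∈ S
  symm := ⟨fun _ _ h => ⟨h.1.symm, h.2.2, h.2.1⟩⟩
  loopless := ⟨fun _ h => h.1.ne rfl⟩

theorem restrictTo_mono {G H : SimpleGraph V} {S T : Set V} (h : G ≤ H) (hS : S ⊆ T) :
    G.restrictTo S ≤ H.restrictTo T :=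
  fun _ _ hxy => ⟨h hxy.1, hS hxy.2.1, hS hxy.2.2⟩

theorem IsAcyclic.induce_of_restrictTo {G : SimpleGraph V} {S : Set V}
    (h : (G.restrictTo S).IsAcyclic) : (G.induce S).IsAcyclic :=
  h.comap (⟨fun x => x.1, fun {x y} hxy => ⟨hxy, x.2, y.2⟩⟩ : G.induce S →g G.restrictTo S)
    Subtype.val_injective

theorem eq_of_reachable_of_forall_not_adj {G : SimpleGraph V} {v a : V}
    (hv : ∀ x, ¬ G.Adj v x) (h : G.Reachable v a) : v = a := by
  obtain ⟨p⟩ := h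
  cases p with
  | nil => rfl
  | cons h _ => exact (hv _ h).elim

theorem IsAcyclic.sup_edge_of_isolated {G : SimpleGraph V} {v : V} (h : G.IsAcyclic)
    (hv : ∀ x, ¬ G.Adj v x) (a : V) : (G ⊔ edge v a).IsAcyclic := by
  by_cases hva : v = a
  · subst hva; simpa using h
  · exact h.sup_edge_of_not_reachable fun hr => hva (eq_of_reachable_of_forall_not_adj hv hr)

/-- Adding to an acyclic graph an isolated vertex joined to two vertices in distinct components. -/
theorem IsAcyclic.sup_edge_sup_edge {G : SimpleGraph V} {v a c : V} (h : G.IsAcyclic)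
    (hv : ∀ x, ¬ G.Adj v x) (hr : G.Reachable a c → a = c) :
    (G ⊔ edge v a ⊔ edge v c).IsAcyclic := by
  by_cases hac : a = c
  · subst hac
    simpa [sup_assoc] using h.sup_edge_of_isolated hv a
  by_cases hva : v = a
  · subst hva
    simpa using h.sup_edge_of_isolated hv c
  by_cases hvc : v = c
  · subst hvc
    simpa using h.sup_edge_of_isolated hv a
  -- With the edge `a c` and the pendant edge `v a` the graph is still a forest. Hence `v a` alone
  -- does not connect `a`, nor therefore `v`, to `c`, and `v c` may replace `a c`.
  have h1 : (G ⊔ edge a c).IsAcyclic := h.sup_edge_of_not_reachable fun h' => hac (hr h')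
  have h2 : (G ⊔ edge a c ⊔ edge v a).IsAcyclic := by
    refine h1.sup_edge_of_isolated (fun x hx => ?_) a
    simp only [sup_adj, edge_adj] at hx
    rcases hx with hx | ⟨⟨rfl, _⟩ | ⟨rfl, _⟩, _⟩
    · exact hv x hx
    · exact hva rfl
    · exact hvc rfl
  rw [sup_right_comm] at h2
  have h3 := (isAcyclic_sup_fromEdgeSet_iff.1 h2)
  refine h3.1.sup_edge_of_not_reachable fun hvc' => ?_
  have hadj : (G ⊔ edge v a).Adj a v := by simp [edge_adj, Ne.symm hva]
  rcases h3.2 (hadj.reachable.trans hvc') with h | h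
  · exact hac h
  · simp only [sup_adj, edge_adj] at h
    rcases h with h | ⟨⟨h, _⟩ | ⟨_, h⟩, _⟩
    · exact hac (hr h.reachable)
    · exact hva h.symm
    · exact hvc h.symm

/-- A cycle through `v` would use two neighbours in one component of the forest. The choice `a = c`
covers the insertion of a leaf or of an isolated vertex. -/
theorem IsAcyclic.restrictTo_insert {G : SimpleGraph V} {S : Set V} {v : V} (a c : V)
    (h : (G.restrictTo S).IsAcyclic) (hv : v ∉ S) (hN : ∀ x ∈ S, G.Adj v x → x = a ∨ x = c)
    (hr : (G.restrictTo S).Reachable a c → a = c) :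
    (G.restrictTo (insert v S)).IsAcyclic := by
  refine (h.sup_edge_sup_edge (v := v) (fun x hx => hv hx.2.1) hr).anti ?_
  rintro x y ⟨hxy, hx, hy⟩
  simp only [sup_adj, edge_adj]
  rcases hx with rfl | hx
  · rcases hy with rfl | hy
    · exact (hxy.ne rfl).elim
    · rcases hN y hy hxy with rfl | rfl
      · exact Or.inl (Or.inr ⟨Or.inl ⟨rfl, rfl⟩, hxy.ne⟩)
      · exact Or.inr ⟨Or.inl ⟨rfl, rfl⟩, hxy.ne⟩
  · rcases hy with rfl | hy
    · rcases hN x hx hxy.symm with rfl | rfl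
      · exact Or.inl (Or.inr ⟨Or.inr ⟨rfl, rfl⟩, hxy.ne⟩)
      · exact Or.inr ⟨Or.inr ⟨rfl, rfl⟩, hxy.ne⟩
    · exact Or.inl (Or.inl ⟨hxy, hx, hy⟩)

/-! ### Cut colourings and their extension to one more vertex -/

/-- A colouring of `W` that encodes a forest cut of `G[W]`: the vertices coloured `none` form the
cut and induce a forest, and no edge joins the nonempty colour classes `true` and `false`. -/
structure CutColoring (G : SimpleGraph V) (W : Finset V) (c : V → Option Bool) : Prop where
  nonempty : ∀ b, ∃ x ∈ W, c x = some b
  sep : ∀ b, ∀ x ∈ W, ∀ y ∈ W, G.Adj x y → c x = some b → c y ≠ some (!b)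
  acyclic : (G.restrictTo {x | x ∈ W ∧ c x = none}).IsAcyclic

theorem CutColoring.mono {G H : SimpleGraph V} {W : Finset V} {c : V → Option Bool}
    (h : H.CutColoring W c) (hGH : G ≤ H) : G.CutColoring W c :=
  ⟨h.nonempty, fun b x hx y hy hxy => h.sep b x hx y hy (hGH hxy),
    h.acyclic.anti (restrictTo_mono hGH subset_rfl)⟩

theorem CutColoring.exists_isForestCut [Fintype V] {G : SimpleGraph V} {c : V → Option Bool}
    (h : G.CutColoring Finset.univ c) : ∃ S : Set V, G.IsForestCut S := by
  refine ⟨{x | c x = none}, fun hp => ?_, ?_⟩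
  · obtain ⟨x, -, hx⟩ := h.nonempty true
    obtain ⟨y, -, hy⟩ := h.nonempty false
    have hr := hp ⟨x, by simp [hx]⟩ ⟨y, by simp [hy]⟩
    -- The colour `true` spreads along every walk that avoids the cut.
    have key : ∀ u w : ({x | c x = none}ᶜ : Set V),
        (G.induce {x | c x = none}ᶜ).Walk u w → c u = some true → c w = some true := by
      intro u w p
      induction p with
      | nil => exact id
      | @cons u v w huv p ih =>
        intro hu
        apply ih
        have h1 := h.sep true u (by simp) v (by simp) huv hu
        have h2 : c v ≠ none := v.2
        rcases hv : c v with _ | _ | _ <;> simp_all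
    obtain ⟨p⟩ := hr
    have := key _ _ p hx
    simp [hy] at this
  · refine IsAcyclic.induce_of_restrictTo ?_
    simpa using h.acyclic

section extend
variable [DecidableEq V] {G : SimpleGraph V} {W : Finset V} {c : V → Option Bool}

/-- The forest is unchanged, so only a neighbour of the opposite colour can obstruct. Agreement with
`c` on `W` is recorded so that extensions can be chained. -/
theorem CutColoring.extend_some (h : G.CutColoring W c) {v : V} (hv : v ∉ W) (b : Bool)
    (hb : ∀ x ∈ W, G.Adj v x → c x ≠ some (!b)) :
    ∃ c', G.CutColoring (insert v W) c' ∧ c' v = some b ∧ ∀ x ∈ W, c' x = c x := by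
  have hc : ∀ x ∈ W, Function.update c v (some b) x = c x := fun x hx =>
    Function.update_of_ne (ne_of_mem_of_not_mem hx hv) _ _
  refine ⟨Function.update c v (some b), ⟨fun d => ?_, fun d x hx y hy hxy => ?_, ?_⟩, by simp, hc⟩
  · obtain ⟨x, hx, hd⟩ := h.nonempty d
    exact ⟨x, Finset.mem_insert_of_mem hx, (hc x hx).trans hd⟩
  · rcases Finset.mem_insert.1 hx with rfl | hx' <;> rcases Finset.mem_insert.1 hy with rfl | hy'
    · exact (hxy.ne rfl).elim
    · rw [hc y hy', Function.update_self]
      rintro ⟨rfl⟩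
      exact hb y hy' hxy
    · rw [hc x hx', Function.update_self]
      intro hd he
      refine hb x hx' hxy.symm ?_
      simp_all
    · rw [hc x hx', hc y hy']
      exact h.sep d x hx' y hy' hxy
  · refine h.acyclic.anti (restrictTo_mono le_rfl ?_)
    rintro x ⟨hx, hn⟩
    rcases Finset.mem_insert.1 hx with rfl | hx
    · simp at hn
    · exact ⟨hx, (hc x hx).symm.trans hn⟩

/-- A vertex of the cut separates nothing, so the only danger is a cycle in the forest. -/
theorem CutColoring.extend_none₂ (h : G.CutColoring W c) {v : V} (hv : v ∉ W) (a d : V)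
    (hN : ∀ x ∈ W, G.Adj v x → c x = none → x = a ∨ x = d)
    (hr : (G.restrictTo {x | x ∈ W ∧ c x = none}).Reachable a d → a = d) :
    ∃ c', G.CutColoring (insert v W) c' ∧ c' v = none ∧ ∀ x ∈ W, c' x = c x := by
  have hc : ∀ x ∈ W, Function.update c v none x = c x := fun x hx =>
    Function.update_of_ne (ne_of_mem_of_not_mem hx hv) _ _
  refine ⟨Function.update c v none, ⟨fun d => ?_, fun d x hx y hy hxy => ?_, ?_⟩, by simp, hc⟩
  · obtain ⟨x, hx, hd⟩ := h.nonempty d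
    exact ⟨x, Finset.mem_insert_of_mem hx, (hc x hx).trans hd⟩
  · rcases Finset.mem_insert.1 hx with rfl | hx' <;> rcases Finset.mem_insert.1 hy with rfl | hy'
    · exact (hxy.ne rfl).elim
    · simp
    · simp
    · rw [hc x hx', hc y hy']
      exact h.sep d x hx' y hy' hxy
  · refine (IsAcyclic.restrictTo_insert (v := v) a d h.acyclic (fun h => hv h.1)
      (fun x hx hvx => hN x hx.1 hvx hx.2) hr).anti (restrictTo_mono le_rfl ?_)
    rintro x ⟨hx, hn⟩
    rcases Finset.mem_insert.1 hx with rfl | hx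
    · exact Set.mem_insert _ _
    · exact Set.mem_insert_of_mem _ ⟨hx, (hc x hx).symm.trans hn⟩

theorem CutColoring.extend_none (h : G.CutColoring W c) {v : V} (hv : v ∉ W) (a : V)
    (hN : ∀ x ∈ W, G.Adj v x → c x = none → x = a) :
    ∃ c', G.CutColoring (insert v W) c' ∧ c' v = none ∧ ∀ x ∈ W, c' x = c x :=
  h.extend_none₂ hv a a (fun x hx hvx hn => Or.inl (hN x hx hvx hn)) fun _ => rfl

end extend

/-! ### Degree sums of induced subgraphs -/

open Classical in
/-- The number of neighbours of `x` in `W`. -/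
noncomputable def degIn (G : SimpleGraph V) (W : Finset V) (x : V) : ℕ := (W.filter (G.Adj x)).card

/-- Twice the number of edges of `G[W]`. -/
noncomputable def degSum (G : SimpleGraph V) (W : Finset V) : ℕ := ∑ x ∈ W, G.degIn W x

theorem degSum_erase [DecidableEq V] (G : SimpleGraph V) {W : Finset V} {v : V} (hv : v ∈ W) :
    G.degSum W = G.degSum (W.erase v) + 2 * G.degIn W v := by
  classical
  have h1 : ∀ x, G.degIn W x = G.degIn (W.erase v) x + if G.Adj x v then 1 else 0 := by
    intro x
    unfold degIn
    conv_lhs => rw [← Finset.insert_erase hv, Finset.filter_insert]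
    split_ifs with h
    · rw [Finset.card_insert_of_notMem (by simp)]
    · rfl
  have h2 : G.degIn W v = ∑ x ∈ W.erase v, if G.Adj x v then 1 else 0 := by
    rw [h1 v, if_neg (fun h => h.ne rfl), add_zero, degIn, Finset.card_filter]
    exact Finset.sum_congr rfl fun x _ => by simp only [G.adj_comm]
  unfold degSum
  rw [← Finset.add_sum_erase _ _ hv, Finset.sum_congr rfl fun x _ => h1 x,
    Finset.sum_add_distrib, ← h2]
  ring

theorem degSum_sup_edge_le [DecidableEq V] (G : SimpleGraph V) (W : Finset V) (a b : V) :
    (G ⊔ edge a b).degSum W ≤ G.degSum W + 2 := by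
  classical
  have h1 : ∀ x, (G ⊔ edge a b).degIn W x ≤
      G.degIn W x + ((if x = a then 1 else 0) + if x = b then 1 else 0) := by
    intro x
    unfold degIn
    have : W.filter ((G ⊔ edge a b).Adj x) ⊆ W.filter (G.Adj x) ∪
        ((if x = a then {b} else ∅) ∪ (if x = b then {a} else ∅)) := by
      intro y hy
      simp only [Finset.mem_filter, sup_adj, edge_adj] at hy
      simp only [Finset.mem_union, Finset.mem_filter]
      rcases hy with ⟨hy, h | ⟨⟨rfl, rfl⟩ | ⟨rfl, rfl⟩, _⟩⟩ <;> simp_all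
    refine le_trans (le_of_eq (by congr!)) ((Finset.card_le_card this).trans
      ((Finset.card_union_le _ _).trans ?_))
    refine Nat.add_le_add_left ((Finset.card_union_le _ _).trans ?_) _
    split_ifs <;> simp
  unfold degSum
  refine (Finset.sum_le_sum fun x _ => h1 x).trans ?_
  rw [Finset.sum_add_distrib, Finset.sum_add_distrib, Finset.sum_ite_eq', Finset.sum_ite_eq']
  split_ifs <;> omega

theorem degSum_univ [Fintype V] (G : SimpleGraph V) [Fintype G.edgeSet] :
    G.degSum Finset.univ = 2 * G.edgeFinset.card := by
  classical
  have := G.sum_degrees_eq_twice_card_edges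
  convert this using 1
  · exact Finset.sum_congr rfl fun x _ => by
      rw [degIn, ← card_neighborFinset_eq_degree]; congr 1; ext; simp
  · congr!

/-- Listing some neighbours of `x` in `W` bounds `degIn` from below. -/
theorem card_le_degIn {G : SimpleGraph V} {W s : Finset V} {x : V}
    (hs : ∀ y ∈ s, y ∈ W ∧ G.Adj x y) : s.card ≤ G.degIn W x := by
  classical
  exact Finset.card_le_card fun y hy => by simpa using hs y hy

theorem le_degIn_erase [DecidableEq V] (G : SimpleGraph V) (W : Finset V) (u v : V) :
    G.degIn W v ≤ G.degIn (W.erase u) v + 1 := by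
  classical
  unfold degIn
  rw [Finset.filter_erase]
  exact Nat.sub_le_iff_le_add.1 Finset.pred_card_le_card_erase

theorem degIn_erase_of_not_adj [DecidableEq V] {G : SimpleGraph V} (W : Finset V) {u v : V}
    (h : ¬ G.Adj v u) : G.degIn (W.erase u) v = G.degIn W v := by
  classical
  unfold degIn
  rw [Finset.filter_erase, Finset.erase_eq_of_notMem (by simp [h])]

theorem mem_of_adj_of_degIn_le {G : SimpleGraph V} {W s : Finset V} {v : V}
    (hs : ∀ y ∈ s, y ∈ W ∧ G.Adj v y) (hc : G.degIn W v ≤ s.card) {x : V} (hx : x ∈ W)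
    (hvx : G.Adj v x) : x ∈ s := by
  classical
  have : s = W.filter (G.Adj v) :=
    Finset.eq_of_subset_of_card_le (fun y hy => by simpa using hs y hy) hc
  rw [this]; simp [hx, hvx]

/-! ### Forests on at most four vertices -/

theorem isAcyclic_restrictTo_pair (G : SimpleGraph V) {S : Set V} (a b : V)
    (hS : ∀ x ∈ S, x = a ∨ x = b) : (G.restrictTo S).IsAcyclic := by
  have h : (⊥ ⊔ edge a b : SimpleGraph V).IsAcyclic :=
    isAcyclic_bot.sup_edge_of_isolated (fun _ h => h) b
  refine h.anti ?_
  rintro x y ⟨hxy, hx, hy⟩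
  have := hxy.ne
  simp only [sup_adj, edge_adj]
  rcases hS x hx with rfl | rfl <;> rcases hS y hy with rfl | rfl <;> simp_all

theorem isAcyclic_restrictTo_of_card_le_two (G : SimpleGraph V) {S : Finset V}
    (hS : S.card ≤ 2) : (G.restrictTo S).IsAcyclic := by
  classical
  rcases S.eq_empty_or_nonempty with rfl | ⟨a, ha⟩
  · exact isAcyclic_bot.anti fun x y h => by simpa using h.2.1
  · rcases (S.erase a).eq_empty_or_nonempty with h | ⟨b, hb⟩
    · exact isAcyclic_restrictTo_pair G a a fun x hx => by
        by_contra hne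
        have : x ∈ S.erase a := Finset.mem_erase.2 ⟨fun e => hne (Or.inl e), hx⟩
        simp [h] at this
    · refine isAcyclic_restrictTo_pair G a b fun x hx => ?_
      have h1 : ((S.erase a).erase b).card = 0 := by
        rw [Finset.card_erase_of_mem hb, Finset.card_erase_of_mem ha]; omega
      by_contra! h
      have : x ∈ (S.erase a).erase b := by simp_all
      rw [Finset.card_eq_zero.1 h1] at this
      simp at this

/-- Some two of the vertices are not adjacent, so one of them has at most the third vertex as a
neighbour and can be added last. -/
theorem isAcyclic_restrictTo_triple {G : SimpleGraph V} {a b c : V} (hab : a ≠ b) (hac : a ≠ c)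
    (hbc : b ≠ c) (h : ¬ (G.Adj a b ∧ G.Adj b c ∧ G.Adj a c)) :
    (G.restrictTo {a, b, c}).IsAcyclic := by
  have key : ∀ {a b c : V}, a ≠ b → a ≠ c → ¬ G.Adj a b → (G.restrictTo {a, b, c}).IsAcyclic := by
    intro a b c hab hac h
    refine (isAcyclic_restrictTo_pair G b c (S := {b, c}) (by simp)).restrictTo_insert c c
      (by simp [hab, hac]) ?_ fun _ => rfl
    rintro x (rfl | rfl) hx
    · exact (h hx).elim
    · exact Or.inl rfl
  by_cases h1 : G.Adj a b
  · by_cases h2 : G.Adj a c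
    · have := key hbc hab.symm (a := b) (b := c) (c := a) (by tauto)
      refine this.anti (restrictTo_mono le_rfl ?_)
      intro x; simp; tauto
    · have := key hac hab h2
      refine this.anti (restrictTo_mono le_rfl ?_)
      intro x; simp; tauto
  · exact key hab hac h1

/-- Four vertices that do not induce a forest span a triangle or a four-cycle. -/
theorem exists_triangle_or_square {G : SimpleGraph V} {a b c d : V} (hab : a ≠ b) (hac : a ≠ c)
    (had : a ≠ d) (hbc : b ≠ c) (hbd : b ≠ d) (hcd : c ≠ d)
    (h : ¬ (G.restrictTo {a, b, c, d}).IsAcyclic) :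
    (∃ x y z, x ∈ ({a, b, c, d} : Set V) ∧ y ∈ ({a, b, c, d} : Set V) ∧
      z ∈ ({a, b, c, d} : Set V) ∧ G.Adj x y ∧ G.Adj y z ∧ G.Adj x z) ∨
    (G.Adj a b ∧ G.Adj b c ∧ G.Adj c d ∧ G.Adj d a) ∨
    (G.Adj a b ∧ G.Adj b d ∧ G.Adj d c ∧ G.Adj c a) ∨
    (G.Adj a c ∧ G.Adj c b ∧ G.Adj b d ∧ G.Adj d a) := by
  by_cases ht : ∃ x y z, x ∈ ({a, b, c, d} : Set V) ∧ y ∈ ({a, b, c, d} : Set V) ∧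
      z ∈ ({a, b, c, d} : Set V) ∧ G.Adj x y ∧ G.Adj y z ∧ G.Adj x z
  · exact Or.inl ht
  right
  push Not at ht
  -- Every vertex has two neighbours among the others: otherwise it could be added, with at most one
  -- edge, to the forest on the other three, which are not a triangle.
  have key : ∀ p q r s : V, p ≠ q → p ≠ r → p ≠ s → q ≠ r → q ≠ s → r ≠ s →
      ({a, b, c, d} : Set V) = {p, q, r, s} →
      (G.Adj p q ∧ G.Adj p r) ∨ (G.Adj p q ∧ G.Adj p s) ∨ (G.Adj p r ∧ G.Adj p s) := by
    intro p q r s hpq hpr hps hqr hqs hrs he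
    rw [he] at h ht
    by_contra hno
    refine h ?_
    have ha := isAcyclic_restrictTo_triple (G := G) hqr hqs hrs
      (fun h' => ht q r s (by simp) (by simp) (by simp) h'.1 h'.2.1 h'.2.2)
    have : ∃ t, ∀ x ∈ ({q, r, s} : Set V), G.Adj p x → x = t := by
      clear ht ha
      simp only [Set.mem_insert_iff, Set.mem_singleton_iff, forall_eq_or_imp, forall_eq]
      by_cases h1 : G.Adj p q
      · exact ⟨q, by grind⟩
      · by_cases h2 : G.Adj p r
        · exact ⟨r, by grind⟩
        · exact ⟨s, by grind⟩
    obtain ⟨t, ht⟩ := this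
    exact ha.restrictTo_insert t t (by simp [hpq, hpr, hps]) (fun x hx hp => Or.inl (ht x hx hp))
      fun _ => rfl
  have ka := key a b c d hab hac had hbc hbd hcd rfl
  have kb := key b a c d hab.symm hbc hbd hac had hcd (Set.insert_comm _ _ _)
  have kc := key c a b d hac.symm hbc.symm hcd hab had hbd 
    (by rw [Set.insert_comm b c, Set.insert_comm a c])
  have kd := key d a b c had.symm hbd.symm hcd.symm hab hac hbc 
    (by rw [Set.pair_comm c d, Set.insert_comm b d, Set.insert_comm a d])
  rw [G.adj_comm b a] at kb
  rw [G.adj_comm c a, G.adj_comm c b] at kc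
  rw [G.adj_comm d a, G.adj_comm d b, G.adj_comm d c] at kd
  rw [G.adj_comm d a, G.adj_comm c a, G.adj_comm d c, G.adj_comm c b]
  -- Four vertices with minimum degree two carry a Hamiltonian cycle; the three alternatives are the
  -- three possible cycles.
  clear key ht h
  grind

/-! ### Minimal counterexamples: small degrees and their neighbourhoods -/

/-- A clique of `H` does not contain both colours, so `v` can take the colour of any coloured
neighbour, or an arbitrary one if all its neighbours are in the cut. -/
theorem CutColoring.extend_of_clique [DecidableEq V] {G H : SimpleGraph V} {W : Finset V}
    {c : V → Option Bool} (h : H.CutColoring W c) (hGH : G ≤ H) {v : V} (hv : v ∉ W)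
    (hN : ∀ x ∈ W, ∀ y ∈ W, G.Adj v x → G.Adj v y → x ≠ y → H.Adj x y) :
    ∃ c', G.CutColoring (insert v W) c' := by
  by_cases hx : ∃ x ∈ W, G.Adj v x ∧ c x ≠ none
  · obtain ⟨x, hx, hvx, hc⟩ := hx
    obtain ⟨b, hb⟩ := Option.ne_none_iff_exists'.1 hc
    obtain ⟨c', h', -⟩ := (h.mono hGH).extend_some hv b fun y hy hvy => by
      by_cases hxy : x = y
      · subst hxy; simp [hb]
      · exact h.sep b x hx y hy (hN x hx y hy hvx hvy hxy) hb
    exact ⟨c', h'⟩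
  · push Not at hx
    obtain ⟨c', h', -⟩ := (h.mono hGH).extend_some hv true fun y hy hvy => by simp [hx y hy hvy]
    exact ⟨c', h'⟩

/-- `G[W]` is a sparse graph without forest cut, while sparse graphs on proper subsets of `W` have
forest cuts. -/
structure IsMinimalCutFree (G : SimpleGraph V) (W : Finset V) : Prop where
  sparse : 5 * G.degSum W + 36 < 22 * W.card
  not_coloring : ∀ c, ¬ G.CutColoring W c
  coloring : ∀ W' ⊂ W, ∀ H : SimpleGraph V, 5 * H.degSum W' + 36 < 22 * W'.card →
    ∃ c, H.CutColoring W' c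

namespace IsMinimalCutFree

variable {G : SimpleGraph V} {W : Finset V}

/-- Two nonadjacent vertices are separated by the others, which form a forest if there are at most
two. Complete graphs on at most four vertices are too dense; on three vertices the bound is attained
with equality. -/
theorem five_le_card (M : G.IsMinimalCutFree W) : 5 ≤ W.card := by
  classical
  by_contra! hW
  have : ∃ x ∈ W, ∃ y ∈ W, x ≠ y ∧ ¬ G.Adj x y := by
    by_contra! h
    have h1 : ∀ x ∈ W, G.degIn W x = W.card - 1 := by
      intro x hx
      rw [degIn, ← Finset.card_erase_of_mem hx]
      congr 1
      ext y
      simp only [Finset.mem_filter, Finset.mem_erase]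
      exact ⟨fun hy => ⟨hy.2.ne', hy.1⟩, fun hy => ⟨hy.2, h x hx y hy.2 hy.1.symm⟩⟩
    have h2 := M.sparse
    rw [degSum, Finset.sum_congr rfl h1, Finset.sum_const, smul_eq_mul] at h2
    generalize W.card = n at *
    interval_cases n <;> omega
  obtain ⟨x, hx, y, hy, hxy, hadj⟩ := this
  refine M.not_coloring (fun z => if z = x then some true else if z = y then some false else none)
    ⟨?_, ?_, ?_⟩
  · rintro (_ | _)
    · exact ⟨y, hy, by simp [hxy.symm]⟩
    · exact ⟨x, hx, by simp⟩
  · have hadj' : ¬ G.Adj y x := fun h => hadj h.symm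
    intro b p _ q _ hpq hp hq
    split_ifs at hp hq <;> simp_all
  · have h1 : ((W.erase x).erase y).card ≤ 2 := by
      rw [Finset.card_erase_of_mem (by simp [hy, hxy.symm]), Finset.card_erase_of_mem hx]; omega
    refine (G.isAcyclic_restrictTo_of_card_le_two h1).anti (restrictTo_mono le_rfl ?_)
    rintro z ⟨hz, hn⟩
    split_ifs at hn
    simp_all

-- Otherwise the neighbourhood of `v` would be a forest cut, separating `v` from a vertex not
-- adjacent to it.
open Classical in
theorem not_isAcyclic_neighbors (M : G.IsMinimalCutFree W) {v : V} (hv : v ∈ W)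
    (hd : G.degIn W v + 1 < W.card) : ¬ (G.restrictTo {x | x ∈ W ∧ G.Adj v x}).IsAcyclic := by
  intro hac
  have : ∃ z ∈ W, z ≠ v ∧ ¬ G.Adj v z := by
    by_contra! h
    have h1 : W.erase v ⊆ W.filter (G.Adj v) := by
      intro z hz
      rw [Finset.mem_erase] at hz
      exact Finset.mem_filter.2 ⟨hz.2, h z hz.2 hz.1⟩
    have h2 := Finset.card_le_card h1
    rw [Finset.card_erase_of_mem hv] at h2
    unfold degIn at hd
    omega
  obtain ⟨z, hz, hzv, hvz⟩ := this
  refine M.not_coloring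
    (fun x => if x = v then some true else if G.Adj v x then none else some false) ⟨?_, ?_, ?_⟩
  · rintro (_ | _)
    · exact ⟨z, hz, by simp [hzv, hvz]⟩
    · exact ⟨v, hv, by simp⟩
  · intro b p _ q _ hpq hp hq
    have := hpq.symm
    split_ifs at hp hq <;> simp_all
  · refine hac.anti (restrictTo_mono le_rfl ?_)
    rintro x ⟨hx, hn⟩
    split_ifs at hn
    exact ⟨hx, by assumption⟩

/-- Up to three neighbours that do not form a forest must be a triangle. Deleting `v` then gains 30
and costs 22, and `v` can be put back over the clique. -/
theorem four_le_degIn (M : G.IsMinimalCutFree W) {v : V} (hv : v ∈ W) : 4 ≤ G.degIn W v := by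
  classical
  by_contra! hd
  have hn := M.five_le_card
  have hac := M.not_isAcyclic_neighbors hv (by omega)
  have hs : {x | x ∈ W ∧ G.Adj v x} = (W.filter (G.Adj v) : Set V) := by ext; simp
  have h3 : (W.filter (G.Adj v)).card = 3 := by
    by_contra h3
    rw [hs] at hac
    exact hac (G.isAcyclic_restrictTo_of_card_le_two (by unfold degIn at hd; omega))
  obtain ⟨a, b, c, hab, hac', hbc, he⟩ := Finset.card_eq_three.1 h3
  have ht : G.Adj a b ∧ G.Adj b c ∧ G.Adj a c := by
    by_contra ht
    refine hac ((isAcyclic_restrictTo_triple hab hac' hbc ht).anti (restrictTo_mono le_rfl ?_))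
    rw [hs, he]; simp
  have hmem : ∀ x ∈ W, G.Adj v x → x = a ∨ x = b ∨ x = c := by
    intro x hx hvx
    have : x ∈ W.filter (G.Adj v) := by simp [hx, hvx]
    rw [he] at this
    simpa using this
  have hsum := G.degSum_erase hv
  have hd3 : G.degIn W v = 3 := h3
  have hlt := M.sparse
  obtain ⟨col, hcol⟩ := M.coloring _ (Finset.erase_ssubset hv) G (by
    rw [Finset.card_erase_of_mem hv]; omega)
  obtain ⟨c', hc'⟩ := hcol.extend_of_clique le_rfl (v := v) (by simp) (by
    intro x hx y hy hvx hvy hxy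
    have := ht.1.symm; have := ht.2.1.symm; have := ht.2.2.symm
    rcases hmem x (Finset.mem_of_mem_erase hx) hvx with rfl | rfl | rfl <;>
    rcases hmem y (Finset.mem_of_mem_erase hy) hvy with rfl | rfl | rfl <;> tauto)
  rw [Finset.insert_erase hv] at hc'
  exact M.not_coloring _ hc'

theorem six_le_card (M : G.IsMinimalCutFree W) : 6 ≤ W.card := by
  have h1 : W.card • 4 ≤ G.degSum W := Finset.card_nsmul_le_sum _ _ _ fun x hx => M.four_le_degIn hx
  have h2 := M.sparse
  have h3 := M.five_le_card
  rw [smul_eq_mul] at h1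
  omega

/-- The neighbourhood of a vertex of degree four contains no four-cycle. -/
theorem not_square (M : G.IsMinimalCutFree W) {v a b c d : V} (hv : v ∈ W)
    (hd : G.degIn W v = 4) (ha : a ∈ W) (hb : b ∈ W) (hc : c ∈ W) (hd' : d ∈ W)
    (hva : G.Adj v a) (hvb : G.Adj v b) (hvc : G.Adj v c) (hvd : G.Adj v d)
    (hac : a ≠ c) (hbd : b ≠ d) (hab : G.Adj a b) (hbc : G.Adj b c) (hcd : G.Adj c d)
    (hda : G.Adj d a) : False := by
  classical
  have hmem : ∀ x ∈ W.erase v, G.Adj v x → x = a ∨ x = b ∨ x = c ∨ x = d := by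
    intro x hx hvx
    have := mem_of_adj_of_degIn_le (s := {a, b, c, d}) (W := W) (v := v) (G := G)
      (by simp_all) (by
        have := hab.ne; have := hbc.ne; have := hcd.ne; have := hda.ne'
        simp [*]) (Finset.mem_of_mem_erase hx) hvx
    simpa using this
  have ha' : a ∈ W.erase v := by simp [ha, hva.ne']
  have hb' : b ∈ W.erase v := by simp [hb, hvb.ne']
  have hc' : c ∈ W.erase v := by simp [hc, hvc.ne']
  have hd'' : d ∈ W.erase v := by simp [hd', hvd.ne']
  have hsum := G.degSum_erase hv
  have hlt := M.sparse
  -- Deleting `v` gains 40 and costs 22; the remaining 18 pays for one new edge.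
  have hcol : ∀ p q : V, ∃ col, (G ⊔ edge p q).CutColoring (W.erase v) col := fun p q =>
    M.coloring _ (Finset.erase_ssubset hv) _ (by
      have := G.degSum_sup_edge_le (W.erase v) p q
      rw [Finset.card_erase_of_mem hv]; omega)
  have hno : ∀ col, ¬ G.CutColoring (insert v (W.erase v)) col := by
    rw [Finset.insert_erase hv]; exact M.not_coloring
  by_cases hac' : G.Adj a c
  -- One diagonal is present and the other is added, so the neighbourhood becomes a clique.
  · obtain ⟨col, hcol⟩ := hcol b d
    obtain ⟨c', hc'⟩ := hcol.extend_of_clique le_sup_left (v := v) (by simp) (by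
      intro x hx y hy hvx hvy hxy
      have h1 : (G ⊔ edge b d).Adj b d := by simp [edge_adj, hbd]
      have h2 := h1.symm
      have := hac'.symm
      rcases hmem x hx hvx with rfl | rfl | rfl | rfl <;>
      rcases hmem y hy hvy with rfl | rfl | rfl | rfl <;>
      first
      | exact (hxy rfl).elim
      | assumption
      | exact Or.inl (by first | assumption | exact Adj.symm (by assumption)))
    exact hno _ hc'
  · obtain ⟨col, hcol⟩ := hcol a c
    have hG := hcol.mono (le_sup_left : G ≤ _)
    have hopp : ∀ β, ∃ x ∈ W.erase v, G.Adj v x ∧ col x = some (!β) := by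
      intro β
      by_contra! h
      obtain ⟨c', h', -⟩ := hG.extend_some (v := v) (by simp) β h
      exact hno _ h'
    have hadj : (G ⊔ edge a c).Adj a c := by simp [edge_adj, hac]
    have hac2 := fun β => hcol.sep β a ha' c hc' hadj
    have hab2 := fun β => hG.sep β a ha' b hb' hab
    have hbc2 := fun β => hG.sep β b hb' c hc' hbc
    have hcd2 := fun β => hG.sep β c hc' d hd'' hcd
    have hda2 := fun β => hG.sep β d hd'' a ha' hda
    -- By `hopp` both colours occur around `v`. In the cycle with the diagonal `a c`, both `a` and
    -- `c` are adjacent to all the others, so neither is coloured, and the two colours fall on `b`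
    -- and `d`.
    have hnone : col a = none ∧ col c = none ∧ col b ≠ none ∧ col d ≠ none := by
      obtain ⟨x, hx, hvx, hx'⟩ := hopp true
      obtain ⟨y, hy, hvy, hy'⟩ := hopp false
      have tri : ∀ o : Option Bool, o = none ∨ o = some true ∨ o = some false := by decide
      have := tri (col a)
      have := tri (col c)
      clear hopp hadj hcol hG hno hsum hlt M
      simp only [Bool.forall_bool, Bool.not_true, Bool.not_false] at *
      rcases hmem x hx hvx with rfl | rfl | rfl | rfl <;>
      rcases hmem y hy hvy with rfl | rfl | rfl | rfl <;>
      grind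
    -- The cut was a forest with the edge `a c` included, and this edge is not in `G`. So `a` and
    -- `c` lie in distinct components of the cut, and `v` can join it.
    have hacyc := (isAcyclic_sup_fromEdgeSet_iff (u := a) (v := c)
      (G := G.restrictTo {x | x ∈ W.erase v ∧ col x = none})).1 (hcol.acyclic.anti (by
        rintro x y (h | h)
        · exact ⟨Or.inl h.1, h.2⟩
        · refine ⟨Or.inr h, ?_⟩
          rw [edge_adj] at h
          rcases h with ⟨⟨rfl, rfl⟩ | ⟨rfl, rfl⟩, -⟩
          · exact ⟨⟨ha', hnone.1⟩, ⟨hc', hnone.2.1⟩⟩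
          · exact ⟨⟨hc', hnone.2.1⟩, ⟨ha', hnone.1⟩⟩))
    obtain ⟨c', h', -⟩ := hG.extend_none₂ (v := v) (by simp) a c (by
      intro x hx hvx hx'
      rcases hmem x hx hvx with rfl | rfl | rfl | rfl <;> simp_all) (fun h =>
        (hacyc.2 h).elim id fun h => (hac' h.1).elim)
    exact hno _ h'

/-- A vertex of degree four lies in a complete graph on four vertices. -/
theorem exists_triangle (M : G.IsMinimalCutFree W) {v : V} (hv : v ∈ W) (hd : G.degIn W v = 4) :
    ∃ x y z, (x ∈ W ∧ y ∈ W ∧ z ∈ W) ∧ (G.Adj v x ∧ G.Adj v y ∧ G.Adj v z) ∧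
      G.Adj x y ∧ G.Adj y z ∧ G.Adj x z := by
  classical
  have hn := M.six_le_card
  have hac := M.not_isAcyclic_neighbors hv (by omega)
  have hs : {x | x ∈ W ∧ G.Adj v x} = (W.filter (G.Adj v) : Set V) := by ext; simp
  obtain ⟨a, s, has, he, hs3⟩ := Finset.card_eq_succ.1 (show (W.filter (G.Adj v)).card = 3 + 1 from hd)
  obtain ⟨b, c, d, hbc, hbd, hcd, rfl⟩ := Finset.card_eq_three.1 hs3
  have hmem : ∀ x, x ∈ ({a, b, c, d} : Set V) ↔ x ∈ W ∧ G.Adj v x := by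
    intro x
    rw [← Finset.mem_filter, ← he]
    simp
  rw [show {x | x ∈ W ∧ G.Adj v x} = ({a, b, c, d} : Set V) from
    Set.ext fun x => (hmem x).symm] at hac
  simp only [Finset.mem_insert, Finset.mem_singleton, not_or] at has
  have hA := (hmem a).1 (by simp)
  have hB := (hmem b).1 (by simp)
  have hC := (hmem c).1 (by simp)
  have hD := (hmem d).1 (by simp)
  rcases exists_triangle_or_square has.1 has.2.1 has.2.2 hbc hbd hcd hac with
    ⟨x, y, z, hx, hy, hz, h⟩ | ⟨h1, h2, h3, h4⟩ | ⟨h1, h2, h3, h4⟩ | ⟨h1, h2, h3, h4⟩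
  · rw [hmem] at hx hy hz
    exact ⟨x, y, z, ⟨hx.1, hy.1, hz.1⟩, ⟨hx.2, hy.2, hz.2⟩, h⟩
  · exact (M.not_square hv hd hA.1 hB.1 hC.1 hD.1 hA.2 hB.2 hC.2 hD.2 has.2.1 hbd h1 h2 h3 h4).elim
  · exact (M.not_square hv hd hA.1 hB.1 hD.1 hC.1 hA.2 hB.2 hD.2 hC.2 has.2.2 hbc h1 h2 h3 h4).elim
  · exact (M.not_square hv hd hA.1 hC.1 hB.1 hD.1 hA.2 hC.2 hB.2 hD.2 has.1 hcd h1 h2 h3 h4).elim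

end IsMinimalCutFree

/-! ### Extending colourings to three or five vertices -/

section extend
variable [DecidableEq V] {G : SimpleGraph V} {W : Finset V} {c : V → Option Bool}

/-- Give `v₂` and `v₃` the colour `b`, and `v₁` too if `w₁` permits; otherwise put `v₁` into the
cut, where `k` is its only possible neighbour. -/
theorem CutColoring.extend_triple_of_none (h : G.CutColoring W c) {v₁ v₂ v₃ k w₁ w₂ w₃ : V}
    (hv₁ : v₁ ∉ W) (hv₂ : v₂ ∉ W) (hv₃ : v₃ ∉ W) (h₁₂ : v₁ ≠ v₂) (h₁₃ : v₁ ≠ v₃) (h₂₃ : v₂ ≠ v₃)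
    (hN₁ : ∀ x ∈ W, G.Adj v₁ x → x = k ∨ x = w₁) (hN₂ : ∀ x ∈ W, G.Adj v₂ x → x = k ∨ x = w₂)
    (hN₃ : ∀ x ∈ W, G.Adj v₃ x → x = k ∨ x = w₃) (hk : c k = none) (b : Bool)
    (hb₂ : c w₂ ≠ some (!b)) (hb₃ : c w₃ ≠ some (!b)) :
    ∃ c', G.CutColoring (insert v₁ (insert v₂ (insert v₃ W))) c' := by
  obtain ⟨c₃, h₃, e₃, a₃⟩ := h.extend_some hv₃ b fun x hx hvx => by
    rcases hN₃ x hx hvx with rfl | rfl <;> simp_all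
  obtain ⟨c₂, h₂, e₂, a₂⟩ := h₃.extend_some (v := v₂) (by simp [h₂₃, hv₂]) b fun x hx hvx => by
    rcases Finset.mem_insert.1 hx with rfl | hx
    · simp [e₃]
    · rw [a₃ x hx]; rcases hN₂ x hx hvx with rfl | rfl <;> simp_all
  by_cases hw : c w₁ = some (!b)
  · obtain ⟨c₁, h₁, -⟩ := h₂.extend_none (v := v₁) (by simp [h₁₂, h₁₃, hv₁]) k fun x hx hvx => by
      rcases Finset.mem_insert.1 hx with rfl | hx
      · simp [e₂]
      rw [a₂ x hx]
      rcases Finset.mem_insert.1 hx with rfl | hx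
      · simp [e₃]
      rw [a₃ x hx]; rcases hN₁ x hx hvx with rfl | rfl <;> simp_all
    exact ⟨c₁, h₁⟩
  · obtain ⟨c₁, h₁, -⟩ := h₂.extend_some (v := v₁) (by simp [h₁₂, h₁₃, hv₁]) b fun x hx hvx => by
      rcases Finset.mem_insert.1 hx with rfl | hx
      · simp [e₂]
      rw [a₂ x hx]
      rcases Finset.mem_insert.1 hx with rfl | hx
      · simp [e₃]
      rw [a₃ x hx]; rcases hN₁ x hx hvx with rfl | rfl <;> simp_all
    exact ⟨c₁, h₁⟩

/-- If `u₁` and `u₂` each have at most two neighbours in `W`, a common one `k` and another one, then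
a colouring extends to `u₁` and `u₂` without using the colour `!b`, unless the other neighbours both
have that colour. -/
theorem CutColoring.extend_pair (h : G.CutColoring W c) {u₁ u₂ k w₁ w₂ : V}
    (hu₁ : u₁ ∉ W) (hu₂ : u₂ ∉ W) (h₁₂ : u₁ ≠ u₂)
    (hN₁ : ∀ x ∈ W, G.Adj u₁ x → x = k ∨ x = w₁) (hN₂ : ∀ x ∈ W, G.Adj u₂ x → x = k ∨ x = w₂)
    (b : Bool) (hk : c k ≠ some (!b)) (hw : c w₁ ≠ some (!b) ∨ c w₂ ≠ some (!b)) :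
    ∃ c', G.CutColoring (insert u₁ (insert u₂ W)) c' ∧ (∀ x ∈ W, c' x = c x) ∧
      c' u₁ = (if c w₁ = some (!b) then none else some b) ∧
      c' u₂ = (if c w₂ = some (!b) then none else some b) := by
  have hu₁' : u₁ ∉ insert u₂ W := by simp [h₁₂, hu₁]
  obtain ⟨c₂, h₂, a₂, e₂⟩ : ∃ c', G.CutColoring (insert u₂ W) c' ∧ (∀ x ∈ W, c' x = c x) ∧
      c' u₂ = (if c w₂ = some (!b) then none else some b) := by
    split_ifs with hw₂
    · obtain ⟨c', h', e', a'⟩ := h.extend_none hu₂ k fun x hx hvx => by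
        rcases hN₂ x hx hvx with rfl | rfl <;> simp_all
      exact ⟨c', h', a', e'⟩
    · obtain ⟨c', h', e', a'⟩ := h.extend_some hu₂ b fun x hx hvx => by
        rcases hN₂ x hx hvx with rfl | rfl <;> simp_all
      exact ⟨c', h', a', e'⟩
  have ha : ∀ {c' : V → Option Bool}, (∀ x ∈ insert u₂ W, c' x = c₂ x) →
      (∀ x ∈ W, c' x = c x) ∧ c' u₂ = (if c w₂ = some (!b) then none else some b) :=
    fun a' => ⟨fun x hx => (a' x (Finset.mem_insert_of_mem hx)).trans (a₂ x hx),
      (a' u₂ (Finset.mem_insert_self _ _)).trans e₂⟩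
  by_cases hw₁ : c w₁ = some (!b)
  · have hw₂ : c w₂ ≠ some (!b) := by tauto
    obtain ⟨c', h', e', a'⟩ := h₂.extend_none hu₁' k fun x hx hvx => by
      rcases Finset.mem_insert.1 hx with rfl | hx
      · simp [e₂, hw₂]
      · rw [a₂ x hx]; rcases hN₁ x hx hvx with rfl | rfl <;> simp_all
    exact ⟨c', h', (ha a').1, by rw [e', if_pos hw₁], (ha a').2⟩
  · obtain ⟨c', h', e', a'⟩ := h₂.extend_some hu₁' b fun x hx hvx => by
      rcases Finset.mem_insert.1 hx with rfl | hx
      · rw [e₂]; split_ifs <;> simp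
      · rw [a₂ x hx]; rcases hN₁ x hx hvx with rfl | rfl <;> simp_all
    exact ⟨c', h', (ha a').1, by rw [e', if_neg hw₁], (ha a').2⟩

/-- If `k` is in the cut, two of the three `wᵢ` avoid a common colour. If `k` has colour `b`, then
so can `v₁`; each other `vᵢ` gets `b` or, when `wᵢ` has the opposite colour, joins the cut, where it
meets at most the other one. -/
theorem CutColoring.extend_triple (h : G.CutColoring W c) {v₁ v₂ v₃ k w₁ w₂ w₃ : V}
    (hv₁ : v₁ ∉ W) (hv₂ : v₂ ∉ W) (hv₃ : v₃ ∉ W) (h₁₂ : v₁ ≠ v₂) (h₁₃ : v₁ ≠ v₃) (h₂₃ : v₂ ≠ v₃)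
    (hN₁ : ∀ x ∈ W, G.Adj v₁ x → x = k ∨ x = w₁) (hN₂ : ∀ x ∈ W, G.Adj v₂ x → x = k ∨ x = w₂)
    (hN₃ : ∀ x ∈ W, G.Adj v₃ x → x = k ∨ x = w₃)
    (hk : ∀ b, c k = some b → c w₁ ≠ some (!b)) :
    ∃ c', G.CutColoring (insert v₁ (insert v₂ (insert v₃ W))) c' := by
  rcases hck : c k with _ | b
  · have key : ∀ p q r : Option Bool, (∃ b, q ≠ some (!b) ∧ r ≠ some (!b)) ∨
        (∃ b, p ≠ some (!b) ∧ r ≠ some (!b)) ∨ (∃ b, p ≠ some (!b) ∧ q ≠ some (!b)) := by decide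
    rcases key (c w₁) (c w₂) (c w₃) with ⟨b, hb, hb'⟩ | ⟨b, hb, hb'⟩ | ⟨b, hb, hb'⟩
    · exact h.extend_triple_of_none hv₁ hv₂ hv₃ h₁₂ h₁₃ h₂₃ hN₁ hN₂ hN₃ hck b hb hb'
    · rw [Finset.insert_comm]
      exact h.extend_triple_of_none hv₂ hv₁ hv₃ h₁₂.symm h₂₃ h₁₃ hN₂ hN₁ hN₃ hck b hb hb'
    · rw [Finset.insert_comm v₂, Finset.insert_comm v₁]
      exact h.extend_triple_of_none hv₃ hv₁ hv₂ h₁₃.symm h₂₃.symm h₁₂ hN₃ hN₁ hN₂ hck b hb hb'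
  · have hw₁ := hk b hck
    by_cases hw₂ : c w₂ = some (!b)
    · obtain ⟨c₂, h₂, e₂, a₂⟩ := h.extend_none hv₂ k fun x hx hvx => by
        rcases hN₂ x hx hvx with rfl | rfl <;> simp_all
      by_cases hw₃ : c w₃ = some (!b)
      · obtain ⟨c₃, h₃, e₃, a₃⟩ := h₂.extend_none (v := v₃) (by simp [h₂₃.symm, hv₃]) v₂
          fun x hx hvx => by
            rcases Finset.mem_insert.1 hx with rfl | hx
            · simp
            · rw [a₂ x hx]; rcases hN₃ x hx hvx with rfl | rfl <;> simp_all
        obtain ⟨c₁, h₁, -⟩ := h₃.extend_some (v := v₁) (by simp [h₁₂, h₁₃, hv₁]) b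
          fun x hx hvx => by
            rcases Finset.mem_insert.1 hx with rfl | hx
            · simp [e₃]
            rw [a₃ x hx]
            rcases Finset.mem_insert.1 hx with rfl | hx
            · simp [e₂]
            rw [a₂ x hx]; rcases hN₁ x hx hvx with rfl | rfl <;> simp_all
        exact ⟨c₁, by rwa [Finset.insert_comm v₂]⟩
      · obtain ⟨c', h', a', e₁, e₃⟩ := h.extend_pair hv₁ hv₃ h₁₃ hN₁ hN₃ b (by simp [hck])
          (Or.inl hw₁)
        rw [if_neg hw₁] at e₁
        rw [if_neg hw₃] at e₃
        -- Here `v₂` has no neighbour in the cut, so the witness is arbitrary.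
        obtain ⟨c₁, h₁, -⟩ := h'.extend_none (v := v₂) (by simp [h₁₂.symm, h₂₃, hv₂]) v₂
          fun x hx hvx => by
            rcases Finset.mem_insert.1 hx with rfl | hx
            · simp [e₁]
            rcases Finset.mem_insert.1 hx with rfl | hx
            · simp [e₃]
            rw [a' x hx]; rcases hN₂ x hx hvx with rfl | rfl <;> simp_all
        exact ⟨c₁, by rwa [Finset.insert_comm v₁]⟩
    · obtain ⟨c', h', a', e₁, e₂⟩ := h.extend_pair hv₁ hv₂ h₁₂ hN₁ hN₂ b (by simp [hck])
        (Or.inl hw₁)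
      rw [if_neg hw₁] at e₁
      rw [if_neg hw₂] at e₂
      have hv₃' : v₃ ∉ insert v₁ (insert v₂ W) := by simp [h₁₃.symm, h₂₃.symm, hv₃]
      have he : insert v₁ (insert v₂ (insert v₃ W)) = insert v₃ (insert v₁ (insert v₂ W)) := by
        rw [Finset.insert_comm v₂, Finset.insert_comm v₁]
      rw [he]
      by_cases hw₃ : c w₃ = some (!b)
      · obtain ⟨c₁, h₁, -⟩ := h'.extend_none hv₃' v₃ fun x hx hvx => by
          rcases Finset.mem_insert.1 hx with rfl | hx
          · simp [e₁]
          rcases Finset.mem_insert.1 hx with rfl | hx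
          · simp [e₂]
          rw [a' x hx]; rcases hN₃ x hx hvx with rfl | rfl <;> simp_all
        exact ⟨c₁, h₁⟩
      · obtain ⟨c₁, h₁, -⟩ := h'.extend_some hv₃' b fun x hx hvx => by
          rcases Finset.mem_insert.1 hx with rfl | hx
          · simp [e₁]
          rcases Finset.mem_insert.1 hx with rfl | hx
          · simp [e₂]
          rw [a' x hx]; rcases hN₃ x hx hvx with rfl | rfl <;> simp_all
        exact ⟨c₁, h₁⟩

/-- If for some colour `b` that `k` tolerates neither pair of `wᵢ` is entirely of the opposite
colour, then each `vᵢ` gets `b` or `none`, and `z` gets `b`. Otherwise `k` is in the cut and the two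
pairs have opposite colours; each pair of `vᵢ` copies its `wᵢ`, and `z` joins the cut next to `k`
alone. -/
theorem CutColoring.extend_fan (h : G.CutColoring W c) {z v₁ v₂ v₃ v₄ k w₁ w₂ w₃ w₄ : V}
    (hz : z ∉ W) (hv₁ : v₁ ∉ W) (hv₂ : v₂ ∉ W) (hv₃ : v₃ ∉ W) (hv₄ : v₄ ∉ W)
    (hz₁ : z ≠ v₁) (hz₂ : z ≠ v₂) (hz₃ : z ≠ v₃) (hz₄ : z ≠ v₄)
    (h₁₂ : v₁ ≠ v₂) (h₁₃ : v₁ ≠ v₃) (h₁₄ : v₁ ≠ v₄) (h₂₃ : v₂ ≠ v₃) (h₂₄ : v₂ ≠ v₄) (h₃₄ : v₃ ≠ v₄)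
    (hkW : k ∈ W) (hw₁W : w₁ ∈ W) (hw₂W : w₂ ∈ W)
    (hN : ∀ x ∈ W, G.Adj z x → x = k)
    (hN₁ : ∀ x ∈ W, G.Adj v₁ x → x = k ∨ x = w₁) (hN₂ : ∀ x ∈ W, G.Adj v₂ x → x = k ∨ x = w₂)
    (hN₃ : ∀ x ∈ W, G.Adj v₃ x → x = k ∨ x = w₃) (hN₄ : ∀ x ∈ W, G.Adj v₄ x → x = k ∨ x = w₄)
    (n₁₃ : ¬ G.Adj v₁ v₃) (n₁₄ : ¬ G.Adj v₁ v₄) (n₂₃ : ¬ G.Adj v₂ v₃) (n₂₄ : ¬ G.Adj v₂ v₄)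
    (hk : ∀ b, c k = some b → c w₁ ≠ some (!b) ∧ c w₂ ≠ some (!b) ∧ c w₃ ≠ some (!b) ∧
      c w₄ ≠ some (!b)) :
    ∃ c', G.CutColoring (insert z (insert v₁ (insert v₂ (insert v₃ (insert v₄ W))))) c' := by
  -- No edge joins the two pairs, so each may use its own colour.
  have step : ∀ b b' : Bool, c k ≠ some (!b) → c k ≠ some (!b') →
      (c w₁ ≠ some (!b) ∨ c w₂ ≠ some (!b)) → (c w₃ ≠ some (!b') ∨ c w₄ ≠ some (!b')) →
      ∃ c', G.CutColoring (insert v₁ (insert v₂ (insert v₃ (insert v₄ W)))) c' ∧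
        (∀ x ∈ W, c' x = c x) ∧
        c' v₁ = (if c w₁ = some (!b) then none else some b) ∧
        c' v₂ = (if c w₂ = some (!b) then none else some b) ∧
        c' v₃ = (if c w₃ = some (!b') then none else some b') ∧
        c' v₄ = (if c w₄ = some (!b') then none else some b') := by
    intro b b' hkb hkb' hb hb'
    obtain ⟨c₁, h₁, a₁, e₃, e₄⟩ := h.extend_pair hv₃ hv₄ h₃₄ hN₃ hN₄ b' hkb' hb'
    obtain ⟨c₂, h₂, a₂, e₁, e₂⟩ := h₁.extend_pair (u₁ := v₁) (u₂ := v₂) (k := k) (w₁ := w₁)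
      (w₂ := w₂) (by simp [h₁₃, h₁₄, hv₁]) (by simp [h₂₃, h₂₄, hv₂]) h₁₂ (by
        intro x hx hvx
        rcases Finset.mem_insert.1 hx with rfl | hx
        · exact (n₁₃ hvx).elim
        rcases Finset.mem_insert.1 hx with rfl | hx
        · exact (n₁₄ hvx).elim
        exact hN₁ x hx hvx) (by
        intro x hx hvx
        rcases Finset.mem_insert.1 hx with rfl | hx
        · exact (n₂₃ hvx).elim
        rcases Finset.mem_insert.1 hx with rfl | hx
        · exact (n₂₄ hvx).elim
        exact hN₂ x hx hvx) b (by rwa [a₁ k hkW]) (by rwa [a₁ w₁ hw₁W, a₁ w₂ hw₂W])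
    rw [a₁ w₁ hw₁W] at e₁
    rw [a₁ w₂ hw₂W] at e₂
    exact ⟨c₂, h₂, fun x hx => (a₂ x (by simp [hx])).trans (a₁ x hx), e₁, e₂,
      (a₂ v₃ (by simp)).trans e₃, (a₂ v₄ (by simp)).trans e₄⟩
  have hzn : z ∉ insert v₁ (insert v₂ (insert v₃ (insert v₄ W))) := by
    simp [hz, hz₁, hz₂, hz₃, hz₄]
  have mono : ∀ b, c k ≠ some (!b) → (c w₁ ≠ some (!b) ∨ c w₂ ≠ some (!b)) →
      (c w₃ ≠ some (!b) ∨ c w₄ ≠ some (!b)) →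
      ∃ c', G.CutColoring (insert z (insert v₁ (insert v₂ (insert v₃ (insert v₄ W))))) c' := by
    intro b hkb hb hb'
    obtain ⟨c', h', a', e₁, e₂, e₃, e₄⟩ := step b b hkb hkb hb hb'
    have hite : ∀ P : Prop, ∀ _ : Decidable P, (if P then none else some b) ≠ some (!b) := by
      intro P _; split_ifs <;> simp
    obtain ⟨c'', h'', -⟩ := h'.extend_some hzn b fun x hx hzx => by
      simp only [Finset.mem_insert] at hx
      rcases hx with rfl | rfl | rfl | rfl | hx
      · rw [e₁]; exact hite _ _
      · rw [e₂]; exact hite _ _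
      · rw [e₃]; exact hite _ _
      · rw [e₄]; exact hite _ _
      · rw [a' x hx, hN x hx hzx]; exact hkb
    exact ⟨c'', h''⟩
  rcases hck : c k with _ | b
  · have key : ∀ p q r s : Option Bool,
        (∃ b, (p ≠ some (!b) ∨ q ≠ some (!b)) ∧ (r ≠ some (!b) ∨ s ≠ some (!b))) ∨
        ∃ b, (p = some b ∧ q = some b) ∧ (r = some (!b) ∧ s = some (!b)) := by decide
    rcases key (c w₁) (c w₂) (c w₃) (c w₄) with ⟨b, hb, hb'⟩ | ⟨b, ⟨p, q⟩, r, s⟩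
    · exact mono b (by simp [hck]) hb hb'
    · obtain ⟨c', h', a', e₁, e₂, e₃, e₄⟩ := step b (!b) (by simp [hck]) (by simp [hck])
        (by simp [p]) (by simp [r])
      obtain ⟨c'', h'', -⟩ := h'.extend_none hzn k fun x hx hzx => by
        simp only [Finset.mem_insert] at hx
        rcases hx with rfl | rfl | rfl | rfl | hx
        · simp [e₁, p]
        · simp [e₂, q]
        · simp [e₃, r]
        · simp [e₄, s]
        · exact fun _ => hN x hx hzx
      exact ⟨c'', h''⟩
  · have := hk b hck
    exact mono b (by simp [hck]) (Or.inl this.1) (Or.inl this.2.2.1)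

end extend

/-! ### Two reducible configurations -/

theorem exists_fourth_neighbor {G : SimpleGraph V} {W : Finset V} {v a b c : V}
    (hd : G.degIn W v = 4) (ha : a ∈ W) (hb : b ∈ W) (hc : c ∈ W) (hva : G.Adj v a)
    (hvb : G.Adj v b) (hvc : G.Adj v c) (hab : a ≠ b) (hac : a ≠ c) (hbc : b ≠ c) :
    ∃ w ∈ W, G.Adj v w ∧ w ≠ a ∧ w ≠ b ∧ w ≠ c ∧
      ∀ x ∈ W, G.Adj v x → x = a ∨ x = b ∨ x = c ∨ x = w := by
  classical
  have h1 : (W.filter (G.Adj v) \ {a, b, c}).card = 1 := by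
    rw [Finset.card_sdiff_of_subset (by intro x; simp; rintro (rfl | rfl | rfl) <;> simp_all)]
    rw [show (W.filter (G.Adj v)).card = 4 from hd]
    simp [hab, hac, hbc]
  obtain ⟨w, hw⟩ := Finset.card_eq_one.1 h1
  have hmem : ∀ x, x ∈ W.filter (G.Adj v) \ {a, b, c} ↔ x = w := by simp [hw]
  have hw' := (hmem w).2 rfl
  simp only [Finset.mem_sdiff, Finset.mem_filter, Finset.mem_insert, Finset.mem_singleton] at hw' hmem
  refine ⟨w, hw'.1.1, hw'.1.2, by tauto, by tauto, by tauto, fun x hx hvx => ?_⟩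
  have := hmem x
  tauto

namespace IsMinimalCutFree

variable {G : SimpleGraph V} {W : Finset V}

/-- No complete graph on four vertices contains three vertices of degree four. -/
theorem not_three_degIn_eq_four (M : G.IsMinimalCutFree W) {v₁ v₂ v₃ k : V} (hv₁ : v₁ ∈ W)
    (hv₂ : v₂ ∈ W) (hv₃ : v₃ ∈ W) (hk : k ∈ W) (hd₁ : G.degIn W v₁ = 4) (hd₂ : G.degIn W v₂ = 4)
    (hd₃ : G.degIn W v₃ = 4) (h₁₂ : G.Adj v₁ v₂) (h₁₃ : G.Adj v₁ v₃) (h₂₃ : G.Adj v₂ v₃)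
    (hk₁ : G.Adj v₁ k) (hk₂ : G.Adj v₂ k) (hk₃ : G.Adj v₃ k) : False := by
  classical
  obtain ⟨w₁, hw₁, a₁, n₁₁, n₁₂, n₁₃, hN₁⟩ := exists_fourth_neighbor hd₁ hv₂ hv₃ hk h₁₂ h₁₃ hk₁
    h₂₃.ne hk₂.ne hk₃.ne
  obtain ⟨w₂, hw₂, -, n₂₁, n₂₂, n₂₃, hN₂⟩ := exists_fourth_neighbor hd₂ hv₁ hv₃ hk h₁₂.symm h₂₃ hk₂
    h₁₃.ne hk₁.ne hk₃.ne
  obtain ⟨w₃, hw₃, -, n₃₁, n₃₂, n₃₃, hN₃⟩ := exists_fourth_neighbor hd₃ hv₁ hv₂ hk h₁₃.symm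
    h₂₃.symm hk₃ h₁₂.ne hk₁.ne hk₂.ne
  have hv₂' : v₂ ∈ W.erase v₁ := by simp [hv₂, h₁₂.ne']
  have hv₃' : v₃ ∈ (W.erase v₁).erase v₂ := by simp [hv₃, h₁₃.ne', h₂₃.ne']
  have s₁ := G.degSum_erase hv₁
  have s₂ := G.degSum_erase hv₂'
  have s₃ := G.degSum_erase hv₃'
  have l₂ := G.le_degIn_erase W v₁ v₂
  have l₃ := G.le_degIn_erase W v₁ v₃
  have l₃' := G.le_degIn_erase (W.erase v₁) v₂ v₃
  have hlt := M.sparse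
  have c₁ := Finset.card_erase_add_one hv₁
  have c₂ := Finset.card_erase_add_one hv₂'
  have c₃ := Finset.card_erase_add_one hv₃'
  -- At least 4 + 3 + 2 edges disappear, gaining 90 against 66, which pays for the edge `k w₁`. That
  -- edge keeps `k` and `w₁` from having opposite colours.
  have hle := G.degSum_sup_edge_le (((W.erase v₁).erase v₂).erase v₃) k w₁
  have hsub : ((W.erase v₁).erase v₂).erase v₃ ⊂ W :=
    (Finset.erase_ssubset hv₃').trans ((Finset.erase_ssubset hv₂').trans (Finset.erase_ssubset hv₁))
  obtain ⟨c, hc⟩ := M.coloring _ hsub (G ⊔ edge k w₁) (by omega)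
  have hkw : (G ⊔ edge k w₁).Adj k w₁ := by simp [edge_adj, n₁₃.symm]
  obtain ⟨c', hc'⟩ := (hc.mono le_sup_left).extend_triple (v₁ := v₁) (v₂ := v₂) (v₃ := v₃) (k := k)
    (w₁ := w₁) (w₂ := w₂) (w₃ := w₃) (by simp) (by simp) (by simp) h₁₂.ne h₁₃.ne h₂₃.ne
    (by
      intro x hx hvx
      simp only [Finset.mem_erase] at hx
      have := hN₁ x hx.2.2.2 hvx
      tauto)
    (by
      intro x hx hvx
      simp only [Finset.mem_erase] at hx
      have := hN₂ x hx.2.2.2 hvx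
      tauto)
    (by
      intro x hx hvx
      simp only [Finset.mem_erase] at hx
      have := hN₃ x hx.2.2.2 hvx
      tauto)
    (fun b => hc.sep b k (by simp [hk, hk₁.ne', hk₂.ne', hk₃.ne']) w₁
      (by simp [hw₁, a₁.ne', n₁₁, n₁₂]) hkw)
  rw [Finset.insert_erase hv₃', Finset.insert_erase hv₂', Finset.insert_erase hv₁] at hc'
  exact M.not_coloring _ hc'

/-- No vertex of degree five has four neighbours of degree four that are paired up by edges and all
adjacent to the fifth neighbour. -/
theorem not_fan (M : G.IsMinimalCutFree W) {z v₁ v₂ v₃ v₄ k : V} (hz : z ∈ W) (hv₁ : v₁ ∈ W)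
    (hv₂ : v₂ ∈ W) (hv₃ : v₃ ∈ W) (hv₄ : v₄ ∈ W) (hk : k ∈ W) (hd : G.degIn W z = 5)
    (hd₁ : G.degIn W v₁ = 4) (hd₂ : G.degIn W v₂ = 4) (hd₃ : G.degIn W v₃ = 4)
    (hd₄ : G.degIn W v₄ = 4) (hz₁ : G.Adj z v₁) (hz₂ : G.Adj z v₂) (hz₃ : G.Adj z v₃)
    (hz₄ : G.Adj z v₄) (hzk : G.Adj z k) (hk₁ : G.Adj k v₁) (hk₂ : G.Adj k v₂) (hk₃ : G.Adj k v₃)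
    (hk₄ : G.Adj k v₄) (h₁₂ : G.Adj v₁ v₂) (h₃₄ : G.Adj v₃ v₄) (h₁₃ : v₁ ≠ v₃) (h₁₄ : v₁ ≠ v₄)
    (h₂₃ : v₂ ≠ v₃) (h₂₄ : v₂ ≠ v₄) : False := by
  classical
  -- Otherwise `z q k r` would be a four-cycle in the neighbourhood of `p`.
  have hnadj : ∀ {p q r : V}, p ∈ W → q ∈ W → r ∈ W → G.degIn W p = 4 → G.Adj z p → G.Adj z q →
      G.Adj z r → G.Adj k p → G.Adj k q → G.Adj k r → G.Adj p q → q ≠ r → ¬ G.Adj p r :=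
    fun hp hq hr hdp hzp hzq hzr hkp hkq hkr hpq hqr hpr =>
      M.not_square hp hdp hz hq hk hr hzp.symm hpq hkp.symm hpr hzk.ne hqr hzq hkq.symm hkr hzr.symm
  have n₁₃ : ¬ G.Adj v₁ v₃ := hnadj hv₁ hv₂ hv₃ hd₁ hz₁ hz₂ hz₃ hk₁ hk₂ hk₃ h₁₂ h₂₃
  have n₁₄ : ¬ G.Adj v₁ v₄ := hnadj hv₁ hv₂ hv₄ hd₁ hz₁ hz₂ hz₄ hk₁ hk₂ hk₄ h₁₂ h₂₄
  have n₂₃ : ¬ G.Adj v₂ v₃ := hnadj hv₂ hv₁ hv₃ hd₂ hz₂ hz₁ hz₃ hk₂ hk₁ hk₃ h₁₂.symm h₁₃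
  have n₂₄ : ¬ G.Adj v₂ v₄ := hnadj hv₂ hv₁ hv₄ hd₂ hz₂ hz₁ hz₄ hk₂ hk₁ hk₄ h₁₂.symm h₁₄
  obtain ⟨w₁, hw₁, a₁, p₁, q₁, r₁, hN₁⟩ := exists_fourth_neighbor hd₁ hz hk hv₂ hz₁.symm hk₁.symm
    h₁₂ hzk.ne hz₂.ne hk₂.ne
  obtain ⟨w₂, hw₂, a₂, p₂, q₂, r₂, hN₂⟩ := exists_fourth_neighbor hd₂ hz hk hv₁ hz₂.symm hk₂.symm
    h₁₂.symm hzk.ne hz₁.ne hk₁.ne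
  obtain ⟨w₃, hw₃, a₃, p₃, q₃, r₃, hN₃⟩ := exists_fourth_neighbor hd₃ hz hk hv₄ hz₃.symm hk₃.symm
    h₃₄ hzk.ne hz₄.ne hk₄.ne
  obtain ⟨w₄, hw₄, a₄, p₄, q₄, r₄, hN₄⟩ := exists_fourth_neighbor hd₄ hz hk hv₃ hz₄.symm hk₄.symm
    h₃₄.symm hzk.ne hz₃.ne hk₃.ne
  have hN : ∀ x ∈ W, G.Adj z x → x ∈ ({k, v₁, v₂, v₃, v₄} : Finset V) := fun x hx hzx =>
    mem_of_adj_of_degIn_le (by simp [*]) (by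
      have := hk₁.ne; have := hk₂.ne; have := hk₃.ne; have := hk₄.ne
      have := h₁₂.ne; have := h₃₄.ne
      simp [*]) hx hzx
  set W₁ := W.erase z with hW₁
  set W₂ := W₁.erase v₁ with hW₂
  set W₃ := W₂.erase v₂ with hW₃
  set W₄ := W₃.erase v₃ with hW₄
  set W₅ := W₄.erase v₄ with hW₅
  have hmem : ∀ x, x ∈ W₅ ↔ x ≠ v₄ ∧ x ≠ v₃ ∧ x ≠ v₂ ∧ x ≠ v₁ ∧ x ≠ z ∧ x ∈ W := by
    simp [hW₁, hW₂, hW₃, hW₄, hW₅]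
  have m₁ : v₁ ∈ W₁ := by simp [hW₁, hv₁, hz₁.ne']
  have m₂ : v₂ ∈ W₂ := by simp [hW₁, hW₂, hv₂, hz₂.ne', h₁₂.ne']
  have m₃ : v₃ ∈ W₃ := by simp [hW₁, hW₂, hW₃, hv₃, hz₃.ne', h₁₃.symm, h₂₃.symm]
  have m₄ : v₄ ∈ W₄ := by
    simp [hW₁, hW₂, hW₃, hW₄, hv₄, hz₄.ne', h₁₄.symm, h₂₄.symm, h₃₄.ne']
  have s := G.degSum_erase hz
  have s₁ := G.degSum_erase m₁
  have s₂ := G.degSum_erase m₂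
  have s₃ := G.degSum_erase m₃
  have s₄ := G.degSum_erase m₄
  have l₁ := G.le_degIn_erase W z v₁
  have l₂ := G.le_degIn_erase W z v₂
  have l₂' := G.le_degIn_erase W₁ v₁ v₂
  have l₃ := G.le_degIn_erase W z v₃
  have l₃' : G.degIn W₂ v₃ = G.degIn W₁ v₃ := degIn_erase_of_not_adj W₁ fun h => n₁₃ h.symm
  have l₃'' : G.degIn W₃ v₃ = G.degIn W₂ v₃ := degIn_erase_of_not_adj W₂ fun h => n₂₃ h.symm
  have l₄ := G.le_degIn_erase W z v₄
  have l₄' : G.degIn W₂ v₄ = G.degIn W₁ v₄ := degIn_erase_of_not_adj W₁ fun h => n₁₄ h.symm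
  have l₄'' : G.degIn W₃ v₄ = G.degIn W₂ v₄ := degIn_erase_of_not_adj W₂ fun h => n₂₄ h.symm
  have l₄''' := G.le_degIn_erase W₃ v₃ v₄
  have hlt := M.sparse
  have c₀ := Finset.card_erase_add_one hz
  have c₁ := Finset.card_erase_add_one m₁
  have c₂ := Finset.card_erase_add_one m₂
  have c₃ := Finset.card_erase_add_one m₃
  have c₄ := Finset.card_erase_add_one m₄
  rw [← hW₁] at s c₀ l₁ l₂ l₃ l₄
  rw [← hW₂] at s₁ c₁ l₂'
  rw [← hW₃] at s₂ c₂
  rw [← hW₄] at s₃ c₃ l₄'''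
  rw [← hW₅] at s₄ c₄
  -- At least 5 + 3 + 2 + 3 + 2 = 15 edges disappear, gaining 150 against 110; the surplus of 40
  -- pays exactly for the four edges from `k` to the `wᵢ`.
  have e₁ := G.degSum_sup_edge_le W₅ k w₁
  have e₂ := (G ⊔ edge k w₁).degSum_sup_edge_le W₅ k w₂
  have e₃ := (G ⊔ edge k w₁ ⊔ edge k w₂).degSum_sup_edge_le W₅ k w₃
  have e₄ := (G ⊔ edge k w₁ ⊔ edge k w₂ ⊔ edge k w₃).degSum_sup_edge_le W₅ k w₄
  have hsub : W₅ ⊂ W := by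
    refine Finset.ssubset_iff_subset_ne.2 ⟨fun x hx => ((hmem x).1 hx).2.2.2.2.2, fun h => ?_⟩
    rw [h] at c₄
    omega
  obtain ⟨c, hc⟩ := M.coloring _ hsub _
    (show 5 * (G ⊔ edge k w₁ ⊔ edge k w₂ ⊔ edge k w₃ ⊔ edge k w₄).degSum W₅ + 36 < _ by omega)
  have hkW : k ∈ W₅ := (hmem k).2 ⟨hk₄.ne, hk₃.ne, hk₂.ne, hk₁.ne, hzk.ne', hk⟩
  have hw₁W : w₁ ∈ W₅ := (hmem w₁).2 ⟨fun h => n₁₄ (h ▸ a₁), fun h => n₁₃ (h ▸ a₁), r₁, a₁.ne', p₁, hw₁⟩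
  have hw₂W : w₂ ∈ W₅ := (hmem w₂).2 ⟨fun h => n₂₄ (h ▸ a₂), fun h => n₂₃ (h ▸ a₂), a₂.ne', r₂, p₂, hw₂⟩
  have hw₃W : w₃ ∈ W₅ := (hmem w₃).2
    ⟨r₃, a₃.ne', fun h => n₂₃ (h ▸ a₃).symm, fun h => n₁₃ (h ▸ a₃).symm, p₃, hw₃⟩
  have hw₄W : w₄ ∈ W₅ := (hmem w₄).2
    ⟨a₄.ne', r₄, fun h => n₂₄ (h ▸ a₄).symm, fun h => n₁₄ (h ▸ a₄).symm, p₄, hw₄⟩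
  obtain ⟨c', hc'⟩ := (hc.mono (show G ≤ _ from le_sup_left.trans (le_sup_left.trans
      (le_sup_left.trans le_sup_left)))).extend_fan (z := z) (v₁ := v₁) (v₂ := v₂) (v₃ := v₃)
    (v₄ := v₄) (k := k) (w₁ := w₁) (w₂ := w₂) (w₃ := w₃) (w₄ := w₄) (by simp [hmem])
    (by simp [hmem]) (by simp [hmem]) (by simp [hmem]) (by simp [hmem]) hz₁.ne hz₂.ne hz₃.ne hz₄.ne
    h₁₂.ne h₁₃ h₁₄ h₂₃ h₂₄ h₃₄.ne hkW hw₁W hw₂W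
    (fun x hx hvx => by
      rw [hmem] at hx
      have := hN x hx.2.2.2.2.2 hvx
      simp only [Finset.mem_insert, Finset.mem_singleton] at this
      tauto)
    (fun x hx hvx => by
      rw [hmem] at hx
      have := hN₁ x hx.2.2.2.2.2 hvx
      tauto)
    (fun x hx hvx => by
      rw [hmem] at hx
      have := hN₂ x hx.2.2.2.2.2 hvx
      tauto)
    (fun x hx hvx => by
      rw [hmem] at hx
      have := hN₃ x hx.2.2.2.2.2 hvx
      tauto)
    (fun x hx hvx => by
      rw [hmem] at hx
      have := hN₄ x hx.2.2.2.2.2 hvx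
      tauto)
    n₁₃ n₁₄ n₂₃ n₂₄
    (fun b hb => ⟨hc.sep b k hkW w₁ hw₁W (by simp [edge_adj, q₁.symm]) hb,
      hc.sep b k hkW w₂ hw₂W (by simp [edge_adj, q₂.symm]) hb,
      hc.sep b k hkW w₃ hw₃W (by simp [edge_adj, q₃.symm]) hb,
      hc.sep b k hkW w₄ hw₄W (by simp [edge_adj, q₄.symm]) hb⟩)
  have hU : insert z (insert v₁ (insert v₂ (insert v₃ (insert v₄ W₅)))) = W := by
    rw [Finset.insert_erase m₄, Finset.insert_erase m₃, Finset.insert_erase m₂,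
      Finset.insert_erase m₁, Finset.insert_erase hz]
  rw [hU] at hc'
  exact M.not_coloring _ hc'

end IsMinimalCutFree

/-! ### Discharging -/

namespace IsMinimalCutFree

variable {G : SimpleGraph V} {W : Finset V}

/-- A vertex of degree four lies in a triangle whose other vertices have larger degree. -/
theorem exists_two_large_neighbors (M : G.IsMinimalCutFree W) {v : V} (hv : v ∈ W)
    (hd : G.degIn W v = 4) : ∃ T : Finset V, T.card = 3 ∧
      (∀ x ∈ T, x ∈ W ∧ G.Adj v x ∧ ∀ y ∈ T, x ≠ y → G.Adj x y) ∧
      ∃ x ∈ T, ∃ y ∈ T, x ≠ y ∧ 5 ≤ G.degIn W x ∧ 5 ≤ G.degIn W y := by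
  classical
  obtain ⟨x, y, z, ⟨hx, hy, hz⟩, ⟨hvx, hvy, hvz⟩, hxy, hyz, hxz⟩ := M.exists_triangle hv hd
  refine ⟨{x, y, z}, by simp [hxy.ne, hyz.ne, hxz.ne], ?_, ?_⟩
  · have := hxy.symm; have := hyz.symm; have := hxz.symm
    simp [*]
  · have dx := M.four_le_degIn hx
    have dy := M.four_le_degIn hy
    have dz := M.four_le_degIn hz
    have h1 : ¬ (G.degIn W x = 4 ∧ G.degIn W y = 4) := fun h =>
      M.not_three_degIn_eq_four hv hx hy hz hd h.1 h.2 hvx hvy hxy hvz hxz hyz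
    have h2 : ¬ (G.degIn W x = 4 ∧ G.degIn W z = 4) := fun h =>
      M.not_three_degIn_eq_four hv hx hz hy hd h.1 h.2 hvx hvz hxz hvy hxy hyz.symm
    have h3 : ¬ (G.degIn W y = 4 ∧ G.degIn W z = 4) := fun h =>
      M.not_three_degIn_eq_four hv hy hz hx hd h.1 h.2 hvy hvz hyz hvx hxy.symm hxz.symm
    by_cases h4 : G.degIn W x = 4
    · exact ⟨y, by simp, z, by simp, hyz.ne, by omega, by omega⟩
    · by_cases h5 : G.degIn W y = 4
      · exact ⟨x, by simp, z, by simp, hxz.ne, by omega, by omega⟩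
      · exact ⟨x, by simp, y, by simp, hxy.ne, by omega, by omega⟩

open Classical in
/-- If every vertex `v` of degree four selects a triangle `T v` in its neighbourhood that contains
two vertices of larger degree, then no vertex of degree five is selected more than three times. -/
theorem card_selected_le_three (M : G.IsMinimalCutFree W) (T : V → Finset V)
    (hT3 : ∀ v ∈ W, G.degIn W v = 4 → (T v).card = 3)
    (hT : ∀ v ∈ W, G.degIn W v = 4 →
      ∀ x ∈ T v, x ∈ W ∧ G.Adj v x ∧ ∀ y ∈ T v, x ≠ y → G.Adj x y)
    (hT5 : ∀ v ∈ W, G.degIn W v = 4 →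
      ∃ x ∈ T v, ∃ y ∈ T v, x ≠ y ∧ 5 ≤ G.degIn W x ∧ 5 ≤ G.degIn W y)
    {z : V} (hz : z ∈ W) (hd : G.degIn W z = 5) :
    (W.filter fun v => G.degIn W v = 4 ∧ z ∈ T v).card ≤ 3 := by
  by_contra! hcard
  set R := W.filter fun v => G.degIn W v = 4 ∧ z ∈ T v with hR
  set N := W.filter (G.Adj z) with hNdef
  have hRmem : ∀ v, v ∈ R ↔ v ∈ W ∧ G.degIn W v = 4 ∧ z ∈ T v := by simp [hR]
  have hNcard : N.card = 5 := hd
  have hRN : R ⊆ N := by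
    intro v hv
    rw [hRmem] at hv
    exact Finset.mem_filter.2 ⟨hv.1, (hT v hv.1 hv.2.1 z hv.2.2).2.1.symm⟩
  have hlarge : ∀ v ∈ R, ∃ y ∈ T v, y ≠ z ∧ y ∈ N \ R := by
    intro v hv
    rw [hRmem] at hv
    obtain ⟨x, hx, y, hy, hxy, hdx, hdy⟩ := hT5 v hv.1 hv.2.1
    have key : ∀ u ∈ T v, u ≠ z → 5 ≤ G.degIn W u → u ∈ N \ R := by
      intro u hu huz hdu
      have h := hT v hv.1 hv.2.1 u hu
      simp only [Finset.mem_sdiff, hRmem, hNdef, Finset.mem_filter]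
      exact ⟨⟨h.1, (h.2.2 z hv.2.2 huz).symm⟩, fun h' => by omega⟩
    by_cases hxz : x = z
    · exact ⟨y, hy, fun h => hxy (hxz.trans h.symm), key y hy (fun h => hxy (hxz.trans h.symm)) hdy⟩
    · exact ⟨x, hx, hxz, key x hx hxz hdx⟩
  have hRne : R.Nonempty := Finset.card_pos.1 (by omega)
  -- At least four of the five neighbours of `z` select it, and a second large vertex of a selected
  -- triangle is a neighbour that does not. So there is exactly one such neighbour, common to all
  -- these triangles.
  obtain ⟨k, hk⟩ : ∃ k, N \ R = {k} := by
    obtain ⟨v, hv⟩ := hRne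
    obtain ⟨y, -, -, hy⟩ := hlarge v hv
    have h1 := Finset.card_sdiff_add_card_eq_card hRN
    have h2 := Finset.card_pos.2 ⟨y, hy⟩
    exact Finset.card_eq_one.1 (by omega)
  have hR4 : R.card = 4 := by
    have h1 := Finset.card_sdiff_add_card_eq_card hRN
    rw [hk, Finset.card_singleton] at h1
    omega
  have hkN : k ∈ N ∧ k ∉ R := Finset.mem_sdiff.1 (by simp [hk])
  have hzk : G.Adj z k := (Finset.mem_filter.1 hkN.1).2
  have hkT : ∀ v ∈ R, k ∈ T v := by
    intro v hv
    obtain ⟨y, hy, -, hy'⟩ := hlarge v hv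
    rw [hk, Finset.mem_singleton] at hy'
    exact hy' ▸ hy
  -- The third vertex of `T v`, besides `z` and `k`, is a neighbour of `z` and hence in `R`. By
  -- `huniq` below, partners are unique, so `R` splits into two adjacent pairs: a fan.
  have hpartner : ∀ v ∈ R, ∃ u ∈ R, G.Adj v u := by
    intro v hv
    have hkv := hkT v hv
    have hv' := (hRmem v).1 hv
    have h1 : 1 ≤ ((T v).erase z |>.erase k).card := by
      rw [Finset.card_erase_of_mem (Finset.mem_erase.2 ⟨hzk.ne', hkv⟩),
        Finset.card_erase_of_mem hv'.2.2, hT3 v hv'.1 hv'.2.1]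
    obtain ⟨u, hu⟩ := Finset.card_pos.1 h1
    simp only [Finset.mem_erase] at hu
    have h2 := hT v hv'.1 hv'.2.1 u hu.2.2
    refine ⟨u, ?_, h2.2.1⟩
    by_contra huR
    have : u ∈ N \ R := Finset.mem_sdiff.2
      ⟨Finset.mem_filter.2 ⟨h2.1, (h2.2.2 z hv'.2.2 hu.2.1).symm⟩, huR⟩
    rw [hk, Finset.mem_singleton] at this
    exact hu.1 this
  have hW : ∀ v ∈ R, v ∈ W := fun v hv => ((hRmem v).1 hv).1
  have hd4 : ∀ v ∈ R, G.degIn W v = 4 := fun v hv => ((hRmem v).1 hv).2.1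
  have hzv : ∀ v ∈ R, G.Adj z v := fun v hv => (Finset.mem_filter.1 (hRN hv)).2
  have hkv : ∀ v ∈ R, G.Adj k v := fun v hv =>
    (hT v (hW v hv) (hd4 v hv) k (hkT v hv)).2.1.symm
  have huniq : ∀ p ∈ R, ∀ q ∈ R, ∀ r ∈ R, G.Adj p q → G.Adj p r → q = r := by
    intro p hp q hq r hr hpq hpr
    by_contra hqr
    exact M.not_square (hW p hp) (hd4 p hp) hz (hW q hq) (Finset.mem_filter.1 hkN.1).1 (hW r hr)
      (hzv p hp).symm hpq (hkv p hp).symm hpr hzk.ne hqr (hzv q hq) (hkv q hq).symm (hkv r hr)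
      (hzv r hr).symm
  obtain ⟨v₁, h₁⟩ := hRne
  obtain ⟨v₂, h₂, a₁₂⟩ := hpartner v₁ h₁
  have hrest : 1 ≤ ((R.erase v₁).erase v₂).card := by
    rw [Finset.card_erase_of_mem (Finset.mem_erase.2 ⟨a₁₂.ne', h₂⟩), Finset.card_erase_of_mem h₁]
    omega
  obtain ⟨v₃, h₃⟩ := Finset.card_pos.1 hrest
  simp only [Finset.mem_erase] at h₃
  obtain ⟨v₄, h₄, a₃₄⟩ := hpartner v₃ h₃.2.2
  have n₁₄ : v₁ ≠ v₄ := by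
    rintro rfl
    exact h₃.1 (huniq _ h₁ _ h₃.2.2 _ h₂ a₃₄.symm a₁₂)
  have n₂₄ : v₂ ≠ v₄ := by
    rintro rfl
    exact h₃.2.1 (huniq _ h₂ _ h₃.2.2 _ h₁ a₃₄.symm a₁₂.symm)
  exact M.not_fan hz (hW _ h₁) (hW _ h₂) (hW _ h₃.2.2) (hW _ h₄) (Finset.mem_filter.1 hkN.1).1 hd
    (hd4 _ h₁) (hd4 _ h₂) (hd4 _ h₃.2.2) (hd4 _ h₄) (hzv _ h₁) (hzv _ h₂) (hzv _ h₃.2.2) (hzv _ h₄)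
    hzk (hkv _ h₁) (hkv _ h₂) (hkv _ h₃.2.2) (hkv _ h₄) a₁₂ a₃₄ (Ne.symm h₃.2.1) n₁₄
    (Ne.symm h₃.1) n₂₄

/-- A vertex of degree `d` has charge `5 * d - 22`. Degree four lacks 2 and receives 1 from each of
two large vertices of its triangle. Degree five has 3 to give and is asked at most three times; for
`d ≥ 6` the charge is at least `d`. So `5 * degSum` is at least `22 * card`. -/
theorem elim (M : G.IsMinimalCutFree W) : False := by
  classical
  choose! T hT3 hT hT5 using fun (v : V) (hv : v ∈ W) (hd : G.degIn W v = 4) =>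
    M.exists_two_large_neighbors hv hd
  set A := W.filter fun v => G.degIn W v = 4 with hA
  set B := W.filter fun v => ¬ G.degIn W v = 4 with hB
  have hAB : A.card + B.card = W.card := Finset.card_filter_add_card_filter_not _
  have hsum : ∑ x ∈ A, G.degIn W x + ∑ x ∈ B, G.degIn W x = G.degSum W :=
    Finset.sum_filter_add_sum_filter_not _ _ _
  have hsumA : ∑ x ∈ A, G.degIn W x = A.card * 4 := by
    rw [Finset.sum_congr rfl fun x hx => (Finset.mem_filter.1 hx).2, Finset.sum_const, smul_eq_mul]
  have hdouble : ∑ v ∈ A, (B.filter fun z => z ∈ T v).card =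
      ∑ z ∈ B, (A.filter fun v => z ∈ T v).card :=
    Finset.sum_card_bipartiteAbove_eq_sum_card_bipartiteBelow fun v z => z ∈ T v
  have hlow : A.card * 2 ≤ ∑ v ∈ A, (B.filter fun z => z ∈ T v).card := by
    rw [← smul_eq_mul]
    refine Finset.card_nsmul_le_sum _ _ _ fun v hv => ?_
    rw [hA, Finset.mem_filter] at hv
    obtain ⟨x, hx, y, hy, hxy, hdx, hdy⟩ := hT5 v hv.1 hv.2
    rw [← Finset.card_pair hxy]
    refine Finset.card_le_card fun u hu => ?_
    have hxW := (hT v hv.1 hv.2 x hx).1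
    have hyW := (hT v hv.1 hv.2 y hy).1
    rcases Finset.mem_insert.1 hu with rfl | hu
    · simp only [hB, Finset.mem_filter]
      exact ⟨⟨hxW, by omega⟩, hx⟩
    · obtain rfl := Finset.mem_singleton.1 hu
      simp only [hB, Finset.mem_filter]
      exact ⟨⟨hyW, by omega⟩, hy⟩
  have hup : ∑ z ∈ B, ((A.filter fun v => z ∈ T v).card + 22) ≤ ∑ z ∈ B, 5 * G.degIn W z := by
    refine Finset.sum_le_sum fun z hz => ?_
    rw [hB, Finset.mem_filter] at hz
    have h4 := M.four_le_degIn hz.1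
    by_cases h5 : G.degIn W z = 5
    · have := M.card_selected_le_three T hT3 hT hT5 hz.1 h5
      rw [← Finset.filter_filter] at this
      rw [h5]
      exact Nat.add_le_add_right this 22
    · have : (A.filter fun v => z ∈ T v).card ≤ G.degIn W z := card_le_degIn fun v hv => by
        rw [Finset.mem_filter, hA, Finset.mem_filter] at hv
        exact ⟨hv.1.1, (hT v hv.1.1 hv.1.2 z hv.2).2.1.symm⟩
      omega
  rw [Finset.sum_add_distrib, Finset.sum_const, smul_eq_mul, ← Finset.mul_sum] at hup
  have := M.sparse
  omega

end IsMinimalCutFree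

/-- Every induced subgraph with few edges has a forest cut. -/
theorem exists_cutColoring (G : SimpleGraph V) (W : Finset V)
    (h : 5 * G.degSum W + 36 < 22 * W.card) : ∃ c, G.CutColoring W c := by
  induction W using Finset.strongInduction generalizing G with
  | H W ih =>
    by_contra! hno
    exact IsMinimalCutFree.elim ⟨h, hno, fun W' hW' H hH => ih W' hW' H hH⟩

end SimpleGraph

theorem theorem2 {V : Type*} [Fintype V] (G : SimpleGraph V) [Fintype G.edgeSet]
    (hG : (G.edgeFinset.card : ℝ) < 11 / 5 * (Fintype.card V : ℝ) - 18 / 5) :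
    ∃ S : Set V, G.IsForestCut S := by
  have h : 5 * G.edgeFinset.card + 18 < 11 * Fintype.card V := by
    have : (5 * G.edgeFinset.card + 18 : ℝ) < 11 * Fintype.card V := by linarith
    exact_mod_cast this
  obtain ⟨c, hc⟩ := G.exists_cutColoring Finset.univ (by
    rw [SimpleGraph.degSum_univ, Finset.card_univ]; omega)
  exact hc.exists_isForestCut
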